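/- A set-theoretic solution to the Pentagon Equation (PE) is a nonempty set $S$ with a map $s\colon S\times S\to S\times S$ such that $s_{23}s_{13}s_{12}=s_{12}s_{23}$ on $S\times S\times S$; it is bijective if $s$ is, and finite if $S$ is. Two solutions $(S,s)$, $(T,t)$ are isomorphic if there is a bijection $f\colon S\to T$ with $(f\times f)s=t(f\times f)$. For a finite bijective solution write $s(x,y)=(x\cdot y,\theta_x(y))$ and $s^{-1}(x,y)=(\psi_y(x),y\circ x)$; the operations $\cdot$ and $\circ$ are associative. Fix an idempotent $e_0$ of $(S,\cdot)$ and put $1=\theta_{e_0}(e_0)$, $A=1\circ S$ and $G=1\cdot S$. For idempotents $e,f$ of $(S,\cdot)$ and $g,h\in G$ put $e\cdot g\approx f\cdot h$ if $\theta_e=\theta_f$ and $g=h$; the solution is irretractable if $\approx$ is equality. A matched pair of groups $(G,A,\sigma,\delta)$ consists of groups $G,A$, a left action $\sigma\colon A\to\mathrm{Sym}(G)$ and a right action $\delta\colon G\to\mathrm{Sym}(A)$ such that $\sigma_a(xy)=\sigma_a(x)\,\sigma_{\delta_x(a)}(y)$ and $\delta_x(ab)=\delta_{\sigma_b(x)}(a)\,\delta_x(b)$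 for all $a,b\in A$, $x,y\in G$. The solution associated to it is the set $A\times G$ with the map $((a,x),(b,y))\mapsto\big((a,xy),(b\,\delta_x(a)^{-1},\sigma_{\delta_x(a)}(y))\big)$. **Theorem.** Let $(S,s)$ be a finite irretractable bijective solution to the PE. Then $A$ is a group under $\circ$ and $G$ is a group under $\cdot$, and with $$\sigma_a(x)=1\cdot\theta_a(x),\qquad \delta_x(a)=\big(1\circ\psi_{x^{-1}}(a^{-1})\big)^{-1}\qquad(a\in A,\ x\in G),$$ where $x^{-1}$ is the inverse in $(G,\cdot)$ and the other inverses are taken in $(A,\circ)$, the quadruple $(G,A,\sigma,\delta)$ is a matched pair of groups. Moreover, $(S,s)$ is isomorphic to the solution on $A\times G$ associated to this matched pair. -/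

import Mathlib

namespace Pentagon

/-- `s` acting on components 1, 2 of a triple. -/
def s12 {S : Type*} (s : S × S → S × S) : S × S × S → S × S × S :=
  fun p => ((s (p.1, p.2.1)).1, (s (p.1, p.2.1)).2, p.2.2)

/-- `s` acting on components 1, 3 of a triple. -/
def s13 {S : Type*} (s : S × S → S × S) : S × S × S → S × S × S :=
  fun p => ((s (p.1, p.2.2)).1, p.2.1, (s (p.1, p.2.2)).2)

/-- `s` acting on components 2, 3 of a triple. -/
def s23 {S : Type*} (s : S × S → S × S) : S × S × S → S × S × S :=
  fun p => (p.1, s p.2)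

/-- `(S, s)` is a set-theoretic solution of the Pentagon Equation. -/
def IsSolution {S : Type*} (s : S × S → S × S) : Prop :=
  s23 s ∘ s13 s ∘ s12 s = s12 s ∘ s23 s

/-- `f` is a homomorphism of solutions `(S, s) → (T, t)`. -/
def IsSolutionHom {S T : Type*} (s : S × S → S × S) (t : T × T → T × T) (f : S → T) : Prop :=
  ∀ p : S × S, Prod.map f f (s p) = t (Prod.map f f p)

/-- The solutions `(S, s)` and `(T, t)` are isomorphic. -/
def Isomorphic {S T : Type*} (s : S × S → S × S) (t : T × T → T × T) : Prop :=
  ∃ f : S → T, Function.Bijective f ∧ IsSolutionHom s t f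

section Operations

/-- The product `x · y`, where `s (x, y) = (x · y, θ_x y)`. -/
def dot {S : Type*} (s : S × S ≃ S × S) (x y : S) : S := (s (x, y)).1

/-- The map `θ_x`, where `s (x, y) = (x · y, θ_x y)`. -/
def theta {S : Type*} (s : S × S ≃ S × S) (x y : S) : S := (s (x, y)).2

/-- The map `ψ_y`, where `s⁻¹ (x, y) = (ψ_y x, y ∘ x)`. -/
def psi {S : Type*} (s : S × S ≃ S × S) (y x : S) : S := (s.symm (x, y)).1

/-- The product `y ∘ x`, where `s⁻¹ (x, y) = (ψ_y x, y ∘ x)`. -/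
def circ {S : Type*} (s : S × S ≃ S × S) (y x : S) : S := (s.symm (x, y)).2

/-- `e` is an idempotent of `(S, ·)`. -/
def IsIdem {S : Type*} (s : S × S ≃ S × S) (e : S) : Prop := dot s e e = e

/-- The element `1 = θ_{e₀}(e₀)` attached to the chosen idempotent `e₀` of `(S, ·)`. -/
def unit {S : Type*} (s : S × S ≃ S × S) (e₀ : S) : S := theta s e₀ e₀

/-- The set `A = 1 ∘ S`. -/
def setA {S : Type*} (s : S × S ≃ S × S) (e₀ : S) : Set S :=
  Set.range fun z => circ s (unit s e₀) z

/-- The set `G = 1 · S`. -/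
def setG {S : Type*} (s : S × S ≃ S × S) (e₀ : S) : Set S :=
  Set.range fun z => dot s (unit s e₀) z

/-- The relation `≈` defining the retract: `e · g ≈ f · h` if `θ_e = θ_f` and `g = h`, for
idempotents `e, f` of `(S, ·)` and `g, h ∈ 1 · S`. -/
def RetractRel {S : Type*} (s : S × S ≃ S × S) (e₀ x y : S) : Prop :=
  ∃ e f g h : S, IsIdem s e ∧ IsIdem s f ∧ g ∈ setG s e₀ ∧ h ∈ setG s e₀ ∧
    x = dot s e g ∧ y = dot s f h ∧ theta s e = theta s f ∧ g = h

/-- The solution equals its retract: the relation `≈` identifies no two distinct elements. -/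
def Irretractable {S : Type*} (s : S × S ≃ S × S) (e₀ : S) : Prop :=
  ∀ x y : S, RetractRel s e₀ x y → x = y

/-- `σ_a(x) = 1 · θ_a(x)`, for `a ∈ A` and `x ∈ G`. -/
def sigma {S : Type*} (s : S × S ≃ S × S) (e₀ : S) (a : setA s e₀) (x : setG s e₀) :
    setG s e₀ :=
  ⟨dot s (unit s e₀) (theta s a x), Set.mem_range_self _⟩

/-- `δ_x(a) = (1 ∘ ψ_{x⁻¹}(a⁻¹))⁻¹`, for `x ∈ G` and `a ∈ A`, with the inverses taken in the
given group structures on `G` and `A`. -/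
def delta {S : Type*} (s : S × S ≃ S × S) (e₀ : S) [Group (setA s e₀)] [Group (setG s e₀)]
    (x : setG s e₀) (a : setA s e₀) : setA s e₀ :=
  (⟨circ s (unit s e₀) (psi s ((x⁻¹ : setG s e₀) : S) ((a⁻¹ : setA s e₀) : S)),
    Set.mem_range_self _⟩ : setA s e₀)⁻¹

end Operations

/-- `(G, A, σ, δ)` is a matched pair of groups: `σ` is a left action of `A` on the set `G` and
`δ` is a right action of `G` on the set `A`, with the two compatibility conditions. -/
structure IsMatchedPair {G A : Type*} [Group G] [Group A]
    (σ : A → Equiv.Perm G) (δ : G → Equiv.Perm A) : Prop where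
  sigma_one : σ 1 = 1
  sigma_mul : ∀ a b : A, σ (a * b) = σ a * σ b
  delta_one : δ 1 = 1
  delta_mul : ∀ x y : G, δ (x * y) = δ y * δ x
  sigma_prod : ∀ (a : A) (x y : G), σ a (x * y) = σ a x * σ (δ x a) y
  delta_prod : ∀ (x : G) (a b : A), δ x (a * b) = δ (σ b x) a * δ x b

/-- The map on `A × G` associated to `(G, A, σ, δ)`:
`((a, x), (b, y)) ↦ ((a, x y), (b δ_x(a)⁻¹, σ_{δ_x(a)}(y)))`. -/
def matchedMap {G A : Type*} [Group G] [Group A]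
    (σ : A → Equiv.Perm G) (δ : G → Equiv.Perm A) :
    (A × G) × (A × G) → (A × G) × (A × G) :=
  fun p => ((p.1.1, p.1.2 * p.2.2), (p.2.1 * (δ p.1.2 p.1.1)⁻¹, σ (δ p.1.2 p.1.1) p.2.2))

end Pentagon

namespace Pentagon

open Function

/-! ### Componentwise pentagon identities and duality -/

section Identities

variable {S : Type*} {s : S × S ≃ S × S}

/-! Duality (`isSolution_dual`) exchanges `·, θ` with `∘, ψ`, so each identity yields a second one.
Finiteness makes idempotents right identities (`IsIdem.dot_right`), hence `S` is the product of its
idempotents and the group `G`; dually, `A` is a group.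

Each `θ_x` is injective, `x ↦ θ_x` is multiplicative for `∘`, and `θ_{1∘x} = θ_x`. Irretractability
says that idempotents are separated by their `θ` (`Irretractable.eq_of_theta_eq`), so `A` is exactly
the set of idempotents and equations in `A` can be tested on `θ`. Since `δ_x(a) = 1 ∘ (a · x)`
(`coe_delta`), `θ_{δ_x(a)} = θ_{a·x}`, and the matched pair axioms become pentagon identities. The
isomorphism is the inverse of `(a, x) ↦ a · x`. -/

theorem apply_eq (x y : S) : s (x, y) = (dot s x y, theta s x y) := rfl

theorem theta_circ_dot (x y : S) : circ s (theta s x y) (dot s x y) = y :=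
  congrArg Prod.snd (s.symm_apply_apply (x, y))

theorem psi_dot_circ (x y : S) : dot s (psi s y x) (circ s y x) = x :=
  congrArg Prod.fst (s.apply_symm_apply (x, y))

theorem theta_psi_circ (x y : S) : theta s (psi s y x) (circ s y x) = y :=
  congrArg Prod.snd (s.apply_symm_apply (x, y))

/-- The solution `τ s⁻¹ τ`, in which `·, θ` and `∘, ψ` are exchanged. -/
def dual (s : S × S ≃ S × S) : S × S ≃ S × S :=
  ((Equiv.prodComm S S).trans s.symm).trans (Equiv.prodComm S S)

theorem dot_assoc (hs : IsSolution s) (x y z : S) :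
    dot s (dot s x y) z = dot s x (dot s y z) :=
  congrArg (fun p => p.1) (congrFun hs (x, y, z))

theorem theta_dot (hs : IsSolution s) (x y z : S) :
    theta s x (dot s y z) = dot s (theta s x y) (theta s (dot s x y) z) :=
  (congrArg (fun p => p.2.1) (congrFun hs (x, y, z))).symm

theorem theta_theta_dot (hs : IsSolution s) (x y z : S) :
    theta s (theta s x y) (theta s (dot s x y) z) = theta s y z :=
  congrArg (fun p => p.2.2) (congrFun hs (x, y, z))

theorem theta_circ (hs : IsSolution s) (x y z : S) :
    theta s (circ s x y) z = theta s x (theta s y z) := by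
  have h := theta_theta_dot hs (psi s x y) (circ s x y) z
  rw [theta_psi_circ, psi_dot_circ] at h
  exact h.symm

/-- Invert both sides of the pentagon equation and reverse the order of the three factors. -/
theorem isSolution_dual (hs : IsSolution s) : IsSolution (dual s) := by
  funext ⟨z, y, x⟩
  obtain ⟨⟨a, b, c⟩, h⟩ : ∃ p : S × S × S, s12 s (s23 s p) = (x, y, z) := by
    refine ⟨((s.symm (x, y)).1, s.symm ((s.symm (x, y)).2, z)), ?_⟩
    simp [s12, s23]
  have h' : s23 s (s13 s (s12 s (a, b, c))) = (x, y, z) := by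
    rw [← h]; exact congrFun hs (a, b, c)
  simp only [s12, s13, s23, Prod.mk.injEq] at h h'
  obtain ⟨h1, h2, h3⟩ := h
  obtain ⟨k1, k2⟩ := h'
  have e1 : s.symm (x, y) = (a, (s (b, c)).1) := by
    rw [← h1, ← h2]; exact s.symm_apply_apply _
  have e2 : s.symm ((s (b, c)).1, z) = (b, c) := by
    rw [← h3]; exact s.symm_apply_apply _
  have f1 : s.symm (y, z) = ((s (a, b)).2, (s ((s (a, b)).1, c)).2) := by
    rw [← k2]; exact s.symm_apply_apply _
  have f2 : s.symm (x, (s ((s (a, b)).1, c)).2) = ((s (a, b)).1, c) := by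
    rw [← k1]; exact s.symm_apply_apply _
  have f3 : s.symm ((s (a, b)).1, (s (a, b)).2) = (a, b) := s.symm_apply_apply _
  simp [s12, s13, s23, dual, e1, e2, f1, f2, f3]

theorem circ_assoc (hs : IsSolution s) (x y z : S) :
    circ s (circ s x y) z = circ s x (circ s y z) :=
  dot_assoc (isSolution_dual hs) x y z

theorem psi_dot (hs : IsSolution s) (x y z : S) :
    psi s (dot s x y) z = psi s x (psi s y z) :=
  theta_circ (isSolution_dual hs) x y z

/-- The chosen unit is fixed in the sense that `s (1, 1) = (1, 1)`. -/
theorem apply_unit_unit (hs : IsSolution s) {e : S} (he : IsIdem s e) :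
    s (unit s e, unit s e) = (unit s e, unit s e) := by
  have he' : dot s e e = e := he
  have h1 := theta_dot hs e e e
  have h2 := theta_theta_dot hs e e e
  rw [he'] at h1 h2
  exact Prod.ext h1.symm h2

theorem dual_apply_self {u : S} (hu : s (u, u) = (u, u)) : dual s (u, u) = (u, u) := by
  have : s.symm (u, u) = (u, u) := by rw [Equiv.symm_apply_eq, hu]
  simp [dual, this]

theorem isIdem_of_apply {u : S} (hu : s (u, u) = (u, u)) : IsIdem s u := congrArg Prod.fst hu

theorem isIdem_dual_of_apply {u : S} (hu : s (u, u) = (u, u)) : IsIdem (dual s) u :=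
  isIdem_of_apply (dual_apply_self hu)

end Identities

/-! ### Counting arguments and the structure of `(S, ·)` -/

section Finite

variable {S : Type*} [Finite S] {s : S × S ≃ S × S}

/-- An injection of `P` into a set that is no larger is onto; this is how finiteness enters. -/
theorem exists_mem_apply_eq (s : S × S ≃ S × S) {P Q : Set (S × S)} (hm : Set.MapsTo s P Q)
    (hc : Q.ncard ≤ P.ncard) {q : S × S} (hq : q ∈ Q) : s.symm q ∈ P := by
  have h : s '' P = Q := Set.eq_of_subset_of_ncard_le hm.image_subset
    (by rwa [Set.ncard_image_of_injective _ s.injective])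
  rw [← h] at hq
  obtain ⟨p, hp, rfl⟩ := hq
  rwa [s.symm_apply_apply]

theorem exists_dot_dot_eq (hs : IsSolution s) (x y : S) : ∃ z, dot s (dot s x y) z = x := by
  let R : Set S := {r | ∃ z, dot s (dot s x y) z = r}
  -- `s` preserves `R × S`, hence so does `s⁻¹`; applied twice, this strips both factors `y` from
  -- `(x · y) · y`.
  have key : ∀ p q : S, dot s p q ∈ R → p ∈ R := by
    intro p q h
    have hm : Set.MapsTo s (R ×ˢ Set.univ) (R ×ˢ Set.univ) := by
      rintro ⟨_, b⟩ ⟨⟨z, rfl⟩, -⟩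
      exact ⟨⟨dot s z b, (dot_assoc hs _ _ _).symm⟩, trivial⟩
    have := exists_mem_apply_eq s hm le_rfl (q := s (p, q)) ⟨h, trivial⟩
    rw [s.symm_apply_apply] at this
    exact this.1
  exact key x y (key _ y ⟨y, rfl⟩)

theorem exists_circ_circ_eq (hs : IsSolution s) (x y : S) : ∃ z, circ s (circ s x y) z = x :=
  exists_dot_dot_eq (isSolution_dual hs) x y

/-- With `L` the principal left ideal of `v` for `·`, `s` maps `S × L` bijectively onto `L × S`.
With the dual, principal left ideals for `·` and `∘` coincide. -/
theorem circ_eq_or_exists_dot (hs : IsSolution s) (q v : S) :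
    circ s q v = v ∨ ∃ w, circ s q v = dot s w v := by
  let L : Set S := {r | r = v ∨ ∃ w, r = dot s w v}
  have hm : Set.MapsTo s (Set.univ ×ˢ L) (L ×ˢ Set.univ) := by
    rintro ⟨a, _⟩ ⟨-, rfl | ⟨w, rfl⟩⟩
    · exact ⟨Or.inr ⟨a, rfl⟩, trivial⟩
    · exact ⟨Or.inr ⟨dot s a w, (dot_assoc hs _ _ _).symm⟩, trivial⟩
  have hc : (L ×ˢ (Set.univ : Set S)).ncard ≤ ((Set.univ : Set S) ×ˢ L).ncard := by
    rw [Set.ncard_prod, Set.ncard_prod, mul_comm]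
  exact (exists_mem_apply_eq s hm hc (q := (v, q)) ⟨Or.inl rfl, trivial⟩).2

theorem dot_eq_or_exists_circ (hs : IsSolution s) (q v : S) :
    dot s q v = v ∨ ∃ w, dot s q v = circ s w v :=
  circ_eq_or_exists_dot (isSolution_dual hs) q v

/-- Idempotents of `(S, ·)` are right identities. -/
theorem IsIdem.dot_right (hs : IsSolution s) {e : S} (he : IsIdem s e) (x : S) :
    dot s x e = x := by
  have he' : dot s e e = e := he
  have hxe : dot s (dot s x e) e = dot s x e := by rw [dot_assoc hs, he']
  have hu : theta s x e = dot s (theta s x e) (theta s (dot s x e) e) := by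
    rw [← theta_dot hs, he']
  have h1 : circ s (theta s x e) (dot s x e) = e := theta_circ_dot x e
  have h2 : circ s (theta s (dot s x e) e) (dot s x e) = e := by
    have := theta_circ_dot (s := s) (dot s x e) e
    rwa [hxe] at this
  -- Both sides send `x · e` to `e` under left `∘`-multiplication; lying in one left `∘`-ideal, they
  -- agree.
  have huv : theta s x e = theta s (dot s x e) e := by
    rcases dot_eq_or_exists_circ hs (theta s x e) (theta s (dot s x e) e) with h | ⟨w, h⟩
    · rw [hu, h]
    · rw [← hu] at h
      obtain ⟨z, hz⟩ := exists_circ_circ_eq hs (theta s (dot s x e) e) (dot s x e)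
      rw [h, ← hz, ← circ_assoc hs, ← circ_assoc hs, ← h, h1, h2]
  have : s (x, e) = s (dot s x e, e) := by rw [apply_eq, apply_eq, huv, hxe]
  exact (congrArg Prod.fst (s.injective this)).symm

/-- Some `z · w` is idempotent, so right multiplication by `w` undoes that by `z`. -/
theorem dot_right_cancel (hs : IsSolution s) {e : S} (he : IsIdem s e) {x y z : S}
    (h : dot s x z = dot s y z) : x = y := by
  obtain ⟨w, hw⟩ := exists_dot_dot_eq hs e z
  have hz : IsIdem s (dot s z w) := by
    rw [dot_assoc hs] at hw
    have := congrArg (dot s (dot s z w)) hw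
    rw [he.dot_right hs, ← dot_assoc hs, he.dot_right hs] at this
    exact this
  rw [← hz.dot_right hs x, ← hz.dot_right hs y, ← dot_assoc hs, h, dot_assoc hs]

theorem IsIdem.theta (hs : IsSolution s) {e : S} (he : IsIdem s e) (x : S) :
    IsIdem s (theta s x e) := by
  have h := theta_dot hs x e e
  rw [he.dot_right hs, he.dot_right hs] at h
  exact h.symm

/-- The right ideal generated by an idempotent of `(S, ·)` is a group. -/
theorem exists_group (hs : IsSolution s) {u : S} (hu : IsIdem s u) :
    ∃ _ : Group (Set.range fun z => dot s u z),
      (∀ x y : Set.range fun z => dot s u z, ((x * y : Set.range _) : S) = dot s x y) ∧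
      ((1 : Set.range fun z => dot s u z) : S) = u := by
  have hu' : dot s u u = u := hu
  let _ : Mul (Set.range fun z => dot s u z) :=
    ⟨fun x y => ⟨dot s x y, by
      obtain ⟨a, ha⟩ := x.2
      exact ⟨dot s a y, by rw [← ha]; exact (dot_assoc hs u a y).symm⟩⟩⟩
  let _ : One (Set.range fun z => dot s u z) := ⟨⟨u, u, hu⟩⟩
  have hinv : ∀ x : Set.range fun z => dot s u z, ∃ y, x * y = 1 := by
    rintro ⟨_, a, rfl⟩
    obtain ⟨z, hz⟩ := exists_dot_dot_eq hs u a
    refine ⟨⟨dot s u z, z, rfl⟩, Subtype.ext ?_⟩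
    change dot s (dot s u a) (dot s u z) = u
    rw [← dot_assoc hs, hu.dot_right hs, hz]
  choose inv hinv using hinv
  let _ : Inv (Set.range fun z => dot s u z) := ⟨inv⟩
  exact ⟨Group.ofRightAxioms (fun x y z => Subtype.ext (dot_assoc hs _ _ _))
    (fun x => Subtype.ext (hu.dot_right hs _)) hinv, fun x y => rfl, rfl⟩

theorem exists_dot_eq_of_isIdem (hs : IsSolution s) {u : S} (hu : IsIdem s u) (y : S) :
    ∃ z, dot s z y = u := by
  obtain ⟨_, hmul, hone⟩ := exists_group hs hu
  let g : Set.range fun z => dot s u z := ⟨dot s u y, y, rfl⟩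
  refine ⟨(g⁻¹ : Set.range _), ?_⟩
  have h := hmul g⁻¹ g
  rw [inv_mul_cancel, hone] at h
  change u = dot s _ (dot s u y) at h
  rw [← dot_assoc hs, hu.dot_right hs] at h
  exact h.symm

/-! ### Injectivity of `θ` and its cocycle identities -/

section Unit

variable {u : S}

/-- `1 ∘ S` consists of idempotents of `(S, ·)`. -/
theorem isIdem_circ (hs : IsSolution s) (hu : s (u, u) = (u, u)) (z : S) :
    IsIdem s (circ s u z) := by
  have hi := isIdem_of_apply hu
  obtain ⟨w, hw⟩ := exists_circ_circ_eq hs u z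
  have h := theta_circ_dot (s := s) w u
  rw [hi.dot_right hs, ← hw] at h
  -- Cancelling `w` gives `u ∘ z = θ_w(u)`, and `θ_w` preserves idempotents.
  have h' : theta s w (circ s (circ s u z) w) = circ s u z :=
    dot_right_cancel (isSolution_dual hs) (isIdem_dual_of_apply hu) h
  rw [hw] at h'
  rw [← h']
  exact hi.theta hs w

/-- `1 · S` consists of idempotents of `(S, ∘)`. -/
theorem isIdem_dual_dot (hs : IsSolution s) (hu : s (u, u) = (u, u)) (z : S) :
    IsIdem (dual s) (dot s u z) :=
  isIdem_circ (isSolution_dual hs) (dual_apply_self hu) z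

theorem circ_dot_right (hs : IsSolution s) (hu : s (u, u) = (u, u)) (x z : S) :
    circ s x (dot s u z) = x :=
  (isIdem_dual_dot hs hu z).dot_right (isSolution_dual hs) x

theorem theta_dot_unit (hs : IsSolution s) (hu : s (u, u) = (u, u)) (z : S) :
    theta s (dot s u z) u = u := by
  have h := theta_circ_dot (s := s) (dot s u z) u
  rwa [(isIdem_of_apply hu).dot_right hs, circ_dot_right hs hu] at h

theorem theta_unit_injective (hs : IsSolution s) (hu : s (u, u) = (u, u)) :
    Injective (theta s u) := by
  intro y y' h
  have hi := isIdem_of_apply hu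
  have hall : ∀ x, theta s x y = theta s x y' := fun x => by
    have hx : circ s x u = x := (isIdem_dual_of_apply hu).dot_right (isSolution_dual hs) x
    rw [← hx, theta_circ hs, theta_circ hs, h]
  obtain ⟨z, hz⟩ := exists_dot_eq_of_isIdem hs hi y
  obtain ⟨t, ht⟩ := exists_dot_eq_of_isIdem hs hi z
  -- This forces `z · y' = u = z · y` by injectivity of `s`; then `u · y = u · y'`, and `y` is
  -- recovered from `s (u, y)`.
  have h1 : theta s u (dot s z y') = u := by
    rw [theta_dot hs, ← hall, ← theta_dot hs, hz]
    exact congrArg Prod.snd hu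
  have h2 : s (u, dot s z y') = s (dot s u (dot s z y'), u) := by
    rw [apply_eq, apply_eq, h1, theta_dot_unit hs hu, hi.dot_right hs]
  have h3 : dot s z y' = dot s z y :=
    (congrArg Prod.snd (s.injective h2)).trans hz.symm
  have h4 := congrArg (dot s t) h3
  rw [← dot_assoc hs, ← dot_assoc hs, ht] at h4
  rw [← theta_circ_dot (s := s) u y, ← theta_circ_dot (s := s) u y', h, h4]

theorem theta_unit (hs : IsSolution s) (hu : s (u, u) = (u, u)) (y : S) : theta s u y = y := by
  apply theta_unit_injective hs hu
  rw [← theta_circ hs]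
  exact congrArg (fun v => theta s v y) (isIdem_dual_of_apply hu)

theorem theta_injective (hs : IsSolution s) (hu : s (u, u) = (u, u)) (x : S) :
    Injective (theta s x) := by
  obtain ⟨w, hw⟩ :=
    exists_dot_eq_of_isIdem (isSolution_dual hs) (isIdem_dual_of_apply hu) x
  change circ s w x = u at hw
  intro y y' h
  rw [← theta_unit hs hu y, ← theta_unit hs hu y', ← hw, theta_circ hs, theta_circ hs, h]

theorem theta_of_isIdem_dual (hs : IsSolution s) (hu : s (u, u) = (u, u)) {f : S}
    (hf : IsIdem (dual s) f) (y : S) : theta s f y = y := by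
  apply theta_injective hs hu f
  rw [← theta_circ hs]
  exact congrArg (fun v => theta s v y) hf

theorem psi_of_isIdem (hs : IsSolution s) (hu : s (u, u) = (u, u)) {e : S}
    (he : IsIdem s e) (y : S) : psi s e y = y :=
  theta_of_isIdem_dual (isSolution_dual hs) (dual_apply_self hu) he y

/-- `θ_x` carries `e ∘ x` to `e` for every idempotent `e` of `(S, ·)`. -/
theorem theta_circ_of_isIdem (hs : IsSolution s) (hu : s (u, u) = (u, u)) {e : S}
    (he : IsIdem s e) (x : S) : theta s x (circ s e x) = e := by
  have h := theta_psi_circ (s := s) x e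
  rwa [psi_of_isIdem hs hu he] at h

theorem theta_unit_circ (hs : IsSolution s) (hu : s (u, u) = (u, u)) (x y : S) :
    theta s (circ s u x) y = theta s x y := by
  rw [theta_circ hs, theta_unit hs hu]

theorem dot_unit_theta_dot_unit (hs : IsSolution s) (hu : s (u, u) = (u, u)) (x y : S) :
    dot s u (theta s x (dot s u y)) = dot s u (theta s x y) := by
  have hi := isIdem_of_apply hu
  rw [theta_dot hs, ← dot_assoc hs, (hi.theta hs x).dot_right hs, hi.dot_right hs]

/-- `θ_{θ_x(g)}` is a left inverse of `θ_{x · g}` for `g ∈ 1 · S`. -/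
theorem theta_theta_dot_of_range (hs : IsSolution s) (hu : s (u, u) = (u, u)) (x y z : S) :
    theta s (theta s x (dot s u y)) (theta s (dot s x (dot s u y)) z) = z := by
  rw [theta_theta_dot hs, theta_of_isIdem_dual hs hu (isIdem_dual_dot hs hu y)]

/-- The map `θ_{x · y}` depends on `x` only through `θ_x`. -/
theorem theta_dot_congr (hs : IsSolution s) (hu : s (u, u) = (u, u)) {x x' : S}
    (h : ∀ y, theta s x y = theta s x' y) (y z : S) :
    theta s (dot s x y) z = theta s (dot s x' y) z := by
  apply theta_injective hs hu (theta s x y)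
  rw [theta_theta_dot hs, h y, theta_theta_dot hs]

/-- The cocycle identity behind `δ_x(ab) = δ_{σ_b(x)}(a) δ_x(b)`. -/
theorem theta_circ_dot_of_range (hs : IsSolution s) (hu : s (u, u) = (u, u)) (a b y z : S) :
    theta s (dot s (circ s a b) (dot s u y)) z =
      theta s (dot s a (dot s u (theta s b (dot s u y)))) (theta s (dot s b (dot s u y)) z) := by
  have hi := isIdem_of_apply hu
  apply theta_injective hs hu (theta s (circ s a b) (dot s u y))
  rw [theta_theta_dot_of_range hs hu, theta_circ hs, ← dot_assoc hs, hi.dot_right hs,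
    theta_theta_dot hs, theta_theta_dot_of_range hs hu]

end Unit

end Finite

/-! ### Irretractability and the formula for `δ` -/

section MatchedPair

variable {S : Type*} [Finite S] {s : S × S ≃ S × S} {e₀ : S}

theorem Irretractable.eq_of_theta_eq (hs : IsSolution s) (hirr : Irretractable s e₀)
    (hu : s (unit s e₀, unit s e₀) = (unit s e₀, unit s e₀)) {e f : S} (he : IsIdem s e)
    (hf : IsIdem s f) (h : ∀ y, theta s e y = theta s f y) : e = f := by
  have hi := isIdem_of_apply hu
  have hg : unit s e₀ ∈ setG s e₀ := ⟨_, hi⟩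
  exact hirr e f ⟨e, f, _, _, he, hf, hg, hg, (hi.dot_right hs e).symm,
    (hi.dot_right hs f).symm, funext h, rfl⟩

/-- `δ_x(a) = 1 ∘ (a · x)`. -/
theorem coe_delta (hs : IsSolution s)
    (hu : s (unit s e₀, unit s e₀) = (unit s e₀, unit s e₀))
    [Group (setA s e₀)] [Group (setG s e₀)]
    (hA : ∀ a b : setA s e₀, ((a * b : setA s e₀) : S) = circ s a b)
    (hG : ∀ x y : setG s e₀, ((x * y : setG s e₀) : S) = dot s x y)
    (hA1 : ((1 : setA s e₀) : S) = unit s e₀) (hG1 : ((1 : setG s e₀) : S) = unit s e₀)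
    (x : setG s e₀) (a : setA s e₀) :
    (delta s e₀ x a : S) = circ s (unit s e₀) (dot s a x) := by
  have hi := isIdem_of_apply hu
  have hi' := isIdem_dual_of_apply hu
  have hright : ∀ y, circ s y (unit s e₀) = y := hi'.dot_right (isSolution_dual hs)
  obtain ⟨y, hy⟩ := x.2
  have hx : ∀ z, circ s z x = z := fun z => by
    rw [← hy]; exact circ_dot_right hs hu z y
  suffices h : delta s e₀ x a = ⟨circ s (unit s e₀) (dot s a x), _, rfl⟩ from
    congrArg Subtype.val h
  unfold delta
  rw [inv_eq_iff_mul_eq_one]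
  apply Subtype.ext
  rw [hA, hA1]
  change circ s (circ s (unit s e₀) (psi s (x⁻¹ : setG s e₀) (a⁻¹ : setA s e₀)))
    (circ s (unit s e₀) (dot s a x)) = unit s e₀
  set w := psi s (x⁻¹ : setG s e₀) (a⁻¹ : setA s e₀) with hw
  have hψ : psi s x w = (a⁻¹ : setA s e₀) := by
    rw [hw, ← psi_dot hs, ← hG, mul_inv_cancel, hG1, psi_of_isIdem hs hu hi]
  -- `θ_{a⁻¹}` sends `x ∘ w` to `x`; apply `θ_a`.
  have h1 : circ s x w = theta s a x := by
    have h := theta_psi_circ (s := s) w x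
    rw [hψ] at h
    have h' := congrArg (theta s a) h
    rwa [← theta_circ hs, ← hA, mul_inv_cancel, hA1, theta_unit hs hu] at h'
  have h2 : circ s (unit s e₀) w = circ s (unit s e₀) (theta s a x) := by
    rw [← h1, ← circ_assoc hs, hx]
  rw [h2, ← circ_assoc hs, circ_assoc hs _ _ (unit s e₀), hright, circ_assoc hs,
    theta_circ_dot, hx]

end MatchedPair

end Pentagon

/-! ### The matched pair and the isomorphism -/

open Pentagon in
theorem theorem5 {S : Type*} [Finite S] (s : S × S ≃ S × S) (hs : Pentagon.IsSolution s)
    (e₀ : S) (he₀ : Pentagon.IsIdem s e₀) (hirr : Pentagon.Irretractable s e₀) :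
    ∃ (_ : Group (Pentagon.setA s e₀)) (_ : Group (Pentagon.setG s e₀)),
      (∀ a b : Pentagon.setA s e₀, ((a * b : Pentagon.setA s e₀) : S) = Pentagon.circ s a b) ∧
      (∀ x y : Pentagon.setG s e₀, ((x * y : Pentagon.setG s e₀) : S) = Pentagon.dot s x y) ∧
      ∃ (σ : Pentagon.setA s e₀ → Equiv.Perm (Pentagon.setG s e₀))
        (δ : Pentagon.setG s e₀ → Equiv.Perm (Pentagon.setA s e₀)),
        (∀ a x, σ a x = Pentagon.sigma s e₀ a x) ∧
        (∀ x a, δ x a = Pentagon.delta s e₀ x a) ∧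
        Pentagon.IsMatchedPair σ δ ∧
        Pentagon.Isomorphic s (Pentagon.matchedMap σ δ) := by
  have hu := apply_unit_unit hs he₀
  have hi := isIdem_of_apply hu
  have hi' := isIdem_dual_of_apply hu
  obtain ⟨gA, hA, hA1⟩ : ∃ _ : Group (setA s e₀),
      (∀ a b : setA s e₀, ((a * b : setA s e₀) : S) = circ s a b) ∧
        ((1 : setA s e₀) : S) = unit s e₀ := exists_group (isSolution_dual hs) hi'
  obtain ⟨gG, hG, hG1⟩ : ∃ _ : Group (setG s e₀),
      (∀ a b : setG s e₀, ((a * b : setG s e₀) : S) = dot s a b) ∧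
        ((1 : setG s e₀) : S) = unit s e₀ := exists_group hs hi
  have hdot : ∀ x, dot s x (unit s e₀) = x := hi.dot_right hs
  have idemA : ∀ a : setA s e₀, IsIdem s a := by
    rintro ⟨_, z, rfl⟩; exact isIdem_circ hs hu z
  have extA : ∀ {a b : setA s e₀}, (∀ y, theta s a y = theta s b y) → a = b := fun h =>
    Subtype.ext (hirr.eq_of_theta_eq hs hu (idemA _) (idemA _) h)
  have memA : ∀ {e}, IsIdem s e → e ∈ setA s e₀ := fun {e} he =>
    ⟨e, hirr.eq_of_theta_eq hs hu (isIdem_circ hs hu e) he (theta_unit_circ hs hu e)⟩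
  have unitG : ∀ x : setG s e₀, dot s (unit s e₀) x = x := fun x => by
    rw [← hG1, ← hG, one_mul]
  have hδ : ∀ x a, (delta s e₀ x a : S) = circ s (unit s e₀) (dot s a x) :=
    coe_delta hs hu hA hG hA1 hG1
  have θδ : ∀ x a y, theta s (delta s e₀ x a) y = theta s (dot s a x) y := fun x a y => by
    rw [hδ, theta_unit_circ hs hu]
  have σ1 : ∀ x, sigma s e₀ 1 x = x := fun x => Subtype.ext <| by
    change dot s (unit s e₀) (theta s (1 : setA s e₀) x) = x
    rw [hA1, theta_unit hs hu, unitG]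
  have σm : ∀ a b x, sigma s e₀ (a * b) x = sigma s e₀ a (sigma s e₀ b x) :=
    fun a b x => Subtype.ext <| by
      change dot s (unit s e₀) (theta s (a * b : setA s e₀) x) =
        dot s (unit s e₀) (theta s a (dot s (unit s e₀) (theta s b x)))
      rw [dot_unit_theta_dot_unit hs hu, hA, theta_circ hs]
  have δ1 : ∀ a, delta s e₀ 1 a = a := fun a => extA fun y => by rw [θδ, hG1, hdot]
  have δm : ∀ x y a, delta s e₀ (x * y) a = delta s e₀ y (delta s e₀ x a) :=
    fun x y a => extA fun z => by
      rw [θδ, θδ, hG, ← dot_assoc hs, theta_dot_congr hs hu (θδ x a)]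
  refine ⟨gA, gG, hA, hG,
    fun a => ⟨sigma s e₀ a, sigma s e₀ a⁻¹,
      fun x => by rw [← σm, inv_mul_cancel, σ1], fun x => by rw [← σm, mul_inv_cancel, σ1]⟩,
    fun x => ⟨delta s e₀ x, delta s e₀ x⁻¹,
      fun a => by rw [← δm, mul_inv_cancel, δ1], fun a => by rw [← δm, inv_mul_cancel, δ1]⟩,
    fun _ _ => rfl, fun _ _ => rfl, ?_, ?_⟩
  · refine ⟨Equiv.ext σ1, fun a b => Equiv.ext (σm a b), Equiv.ext δ1,
      fun x y => Equiv.ext (δm x y), fun a x y => Subtype.ext ?_, fun x a b => extA fun z => ?_⟩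
    · rw [hG]
      change dot s (unit s e₀) (theta s a (x * y : setG s e₀)) =
        dot s (dot s (unit s e₀) (theta s a x))
          (dot s (unit s e₀) (theta s (delta s e₀ x a) y))
      rw [hG, theta_dot hs, θδ, ← dot_assoc hs, ← dot_assoc hs, hdot]
    · rw [hA, theta_circ hs]
      change theta s (delta s e₀ x (a * b)) z =
        theta s (delta s e₀ (sigma s e₀ b x) a) (theta s (delta s e₀ x b) z)
      rw [θδ, θδ, θδ, hA]
      have h := theta_circ_dot_of_range hs hu a b x z
      rw [unitG] at h
      exact h
  · let F : setA s e₀ × setG s e₀ → S := fun p => dot s p.1 p.2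
    have hF : Function.Bijective F := by
      constructor
      · rintro ⟨a, x⟩ ⟨b, y⟩ h
        change dot s a x = dot s b y at h
        have hxy : x = y := Subtype.ext <| by
          have h' := congrArg (dot s (unit s e₀)) h
          rwa [← dot_assoc hs, ← dot_assoc hs, (idemA a).dot_right hs, (idemA b).dot_right hs,
            unitG, unitG] at h'
        subst hxy
        exact Prod.ext (Subtype.ext (dot_right_cancel hs hi h)) rfl
      · intro x
        -- With `z · x = 1`, the factorization is `x = (x · z) · (1 · x)`.
        obtain ⟨z, hz⟩ := exists_dot_eq_of_isIdem hs hi x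
        have he : IsIdem s (dot s x z) := by
          change dot s (dot s x z) (dot s x z) = dot s x z
          rw [← dot_assoc hs, dot_assoc hs x z x, hz, hdot]
        refine ⟨(⟨dot s x z, memA he⟩, ⟨dot s (unit s e₀) x, x, rfl⟩), ?_⟩
        change dot s (dot s x z) (dot s (unit s e₀) x) = x
        rw [← dot_assoc hs, hdot, dot_assoc hs, hz, hdot]
    let Φ := Equiv.ofBijective F hF
    refine ⟨Φ.symm, Φ.symm.bijective, ?_⟩
    intro p
    obtain ⟨⟨⟨a, x⟩, ⟨b, y⟩⟩, rfl⟩ := (Φ.prodCongr Φ).surjective p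
    -- On `A`, `θ_d` is right division by `d`.
    have hd : ∀ d : setA s e₀, theta s d b = ((b * d⁻¹ : setA s e₀) : S) := fun d => by
      have h := theta_circ_of_isIdem hs hu (idemA (b * d⁻¹)) d
      rwa [← hA, inv_mul_cancel_right] at h
    have hΦ : ∀ a x, Φ (a, x) = dot s a x := fun _ _ => rfl
    have key : s (Φ (a, x), Φ (b, y)) =
        (Φ (a, x * y), Φ (b * (delta s e₀ x a)⁻¹, sigma s e₀ (delta s e₀ x a) y)) := by
      rw [apply_eq]
      simp only [hΦ]
      congr 1
      · rw [hG, ← dot_assoc hs, dot_assoc hs (a : S) x b, (idemA b).dot_right hs, dot_assoc hs]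
      · change _ = dot s _ (dot s (unit s e₀) (theta s (delta s e₀ x a) y))
        rw [← hd, ← dot_assoc hs, hdot, ← θδ, theta_dot hs, (idemA b).dot_right hs]
    change Prod.map Φ.symm Φ.symm (s (Φ (a, x), Φ (b, y))) =
      matchedMap _ _ (Φ.symm (Φ (a, x)), Φ.symm (Φ (b, y)))
    rw [key]
    simp only [Prod.map_apply, Equiv.symm_apply_apply]
    rfl
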